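/- Let $G$ be a finite group. A conjugacy class $C$ of $G$ is called real if $C^{-1}=C$, where $C^{-1}=\{g^{-1}: g\in C\}$, and complex otherwise. Let $C_1,\dots,C_{r_1}$ be the real conjugacy classes of $G$, let $r_2$ be half the number of complex conjugacy classes, and put $$d=d(G)=(-1)^{r_2}\,|G|^{r_1}\prod_{j=1}^{r_1}|C_j|^{-1}.$$ For an integer $a$ define $\left(\frac{a}{G}\right)$ to be $0$ if $\gcd(a,|G|)\neq 1$, and otherwise the sign ($\pm1$) of the permutation of the set of conjugacy classes of $G$ induced by $g\mapsto g^a$. Let $\left(\frac{d}{a}\right)$ be the Kronecker symbol: for $a\ne 0$ it is multiplicative in $a$, it is the Legendre symbol when $a$ is an odd prime, $\left(\frac{d}{2}\right)$ is $0$ if $d$ is even, $1$ if $d\equiv\pm1\pmod 8$ and $-1$ if $d\equiv\pm3\pmod 8$, $\left(\frac{d}{-1}\right)$ is the sign of $d$, and $\left(\frac{d}{0}\right)$ is $1$ if $d=\pm1$ and $0$ otherwise. Then $d$ is a non-zero integer with $d\equiv 0$ or $1\pmod 4$, and for every integer $a$ $$\left(\frac{a}{G}\right)=\left(\frac{d}{a}\right).$$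 In particular, $\left(\frac{\cdot}{G}\right)$ is trivial (that is, $\left(\frac{a}{G}\right)=1$ for every integer $a$ with $\gcd(a,|G|)=1$) if and only if $d$ is the square of an integer. -/

import Mathlib

namespace GroupReciprocity

/-- The Kronecker symbol `(d/p)` at a prime `p`: the Legendre symbol for odd `p`, and the usual
value depending on `d` modulo `8` for `p = 2`. (For `d ≡ 0, 1` modulo `4` the residue `7` does
not occur.) -/
def kroneckerPrime (d : ℤ) (p : ℕ) : ℤ :=
  if p = 2 then
    if d % 2 = 0 then 0 else if d % 8 = 1 ∨ d % 8 = 7 then 1 else -1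
  else jacobiSym d p

/-- The Kronecker symbol `(d/a)` for arbitrary integers `d` and `a`: multiplicative in `a ≠ 0`
over the prime factorization of `|a|` (with multiplicity), with value the sign of `d` at `a = -1`, and
`(d/0) = 0` unless `d` is a unit. -/
def kroneckerSym (d a : ℤ) : ℤ :=
  if a = 0 then (if d = 1 ∨ d = -1 then 1 else 0)
  else (if a < 0 ∧ d < 0 then -1 else 1) *
    (a.natAbs.primeFactorsList.map (kroneckerPrime d)).prod

variable {G : Type*} [Group G]

/-- The map on conjugacy classes induced by `g ↦ g ^ a`. -/
def classPow (a : ℤ) : ConjClasses G → ConjClasses G :=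
  Quotient.map (fun g : G => g ^ a) fun g h hgh => by
    obtain ⟨c, hc⟩ := isConj_iff.1 hgh
    exact isConj_iff.2 ⟨c, by rw [← hc, conj_zpow]⟩

theorem classPow_mk (a : ℤ) (g : G) :
    classPow a (ConjClasses.mk g) = ConjClasses.mk (g ^ a) := rfl

theorem classPow_bijective [Finite G] {a : ℤ} (h : Int.gcd a (Nat.card G) = 1) :
    Function.Bijective (classPow a : ConjClasses G → ConjClasses G) := by
  have key : ∀ g : G, g ^ (a * Int.gcdA a (Nat.card G)) = g := by
    intro g
    have hb := Int.gcd_eq_gcd_ab a (Nat.card G)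
    rw [h] at hb
    have h1 : a * Int.gcdA a (Nat.card G) = 1 - Nat.card G * Int.gcdB a (Nat.card G) := by
      push_cast at hb
      linarith
    rw [h1, zpow_sub, zpow_mul, zpow_natCast, pow_card_eq_one']
    simp
  refine Function.bijective_iff_has_inverse.2 ⟨classPow (Int.gcdA a (Nat.card G)), ?_, ?_⟩
  · intro C
    induction C using Quotient.inductionOn with
    | _ g =>
      change ConjClasses.mk ((g ^ a) ^ _) = ConjClasses.mk g
      rw [← zpow_mul, key]
  · intro C
    induction C using Quotient.inductionOn with
    | _ g =>
      change ConjClasses.mk ((g ^ _) ^ a) = ConjClasses.mk g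
      rw [← zpow_mul, mul_comm, key]

/-- The permutation of the conjugacy classes induced by `g ↦ g ^ a`, for `a` prime to `|G|`. -/
noncomputable def classPerm [Finite G] (a : ℤ) (h : Int.gcd a (Nat.card G) = 1) :
    Equiv.Perm (ConjClasses G) :=
  Equiv.ofBijective (classPow a) (classPow_bijective h)

variable (G) in
open Classical in
/-- The quadratic symbol `(a/G)`: the sign of the permutation of the conjugacy classes induced
by `g ↦ g ^ a` if `a` is prime to `|G|`, and `0` otherwise. -/
noncomputable def quadSym [Finite G] (a : ℤ) : ℤ :=
  letI : Fintype (ConjClasses G) := Fintype.ofFinite _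
  if h : Int.gcd a (Nat.card G) = 1 then (Equiv.Perm.sign (classPerm a h) : ℤ) else 0

/-- A conjugacy class is real if it is mapped onto itself by `g ↦ g⁻¹`. -/
def IsRealClass (C : ConjClasses G) : Prop :=
  (fun g : G => g⁻¹) '' C.carrier = C.carrier

variable (G) in
/-- The number of real conjugacy classes. -/
noncomputable def numReal : ℕ := Nat.card {C : ConjClasses G // IsRealClass C}

variable (G) in
/-- Half the number of conjugacy classes that are not real. (For finite `G` that number is even,
see `card_conjClasses_eq`.) -/
noncomputable def numComplexPairs : ℕ := Nat.card {C : ConjClasses G // ¬ IsRealClass C} / 2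

variable (G) in
/-- `(-1) ^ r₂ * |G| ^ r₁ * ∏ |C|⁻¹`, the product over the real conjugacy classes, as a rational
number. -/
noncomputable def groupDisc : ℚ :=
  (-1) ^ numComplexPairs G * (Nat.card G : ℚ) ^ numReal G *
    ∏ᶠ C : {C : ConjClasses G // IsRealClass C}, ((C.1.carrier.ncard : ℚ))⁻¹

theorem classPow_classPow_neg_one (C : ConjClasses G) : classPow (-1) (classPow (-1) C) = C := by
  induction C using Quotient.inductionOn with
  | _ g =>
    change ConjClasses.mk ((g ^ (-1 : ℤ)) ^ (-1 : ℤ)) = ConjClasses.mk g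
    simp

theorem isRealClass_iff (C : ConjClasses G) : IsRealClass C ↔ classPow (-1) C = C := by
  have himg : (fun g : G => g⁻¹) '' C.carrier = (classPow (-1) C).carrier := by
    ext x
    constructor
    · rintro ⟨g, hg, rfl⟩
      have hg' := ConjClasses.mem_carrier_iff_mk_eq.1 hg
      rw [ConjClasses.mem_carrier_iff_mk_eq, ← hg', classPow_mk]
      simp
    · intro hx
      have hx' := ConjClasses.mem_carrier_iff_mk_eq.1 hx
      refine ⟨x⁻¹, ?_, by simp⟩
      rw [ConjClasses.mem_carrier_iff_mk_eq, ← classPow_classPow_neg_one C, ← hx', classPow_mk]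
      simp
  rw [IsRealClass, himg]
  constructor
  · intro h
    obtain ⟨x, hx⟩ := ConjClasses.exists_rep C
    have hm : x ∈ (classPow (-1) C).carrier := by
      rw [h]; exact ConjClasses.mem_carrier_iff_mk_eq.2 hx
    exact (ConjClasses.mem_carrier_iff_mk_eq.1 hm).symm.trans hx
  · intro h
    rw [h]

variable (G) in
/-- The number of conjugacy classes is `r₁ + 2 r₂`. -/
theorem card_conjClasses_eq [Finite G] :
    Nat.card (ConjClasses G) = numReal G + 2 * numComplexPairs G := by
  classical
  let _ : Fintype (ConjClasses G) := Fintype.ofFinite _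
  have hinv : Function.Involutive (classPow (-1) : ConjClasses G → ConjClasses G) :=
    classPow_classPow_neg_one
  have hmod := Equiv.Perm.card_fixedPoints_modEq (p := 2) (n := 1)
    (f := (classPow (-1) : ConjClasses G → ConjClasses G)) (by
      funext C
      exact hinv C)
  have hreal : Fintype.card (Function.fixedPoints (classPow (-1) : ConjClasses G → _)) =
      numReal G := by
    rw [numReal, ← Nat.card_eq_fintype_card]
    exact Nat.card_congr (Equiv.subtypeEquivRight fun C => (isRealClass_iff C).symm)
  have hsum : Nat.card (ConjClasses G) =
      numReal G + Nat.card {C : ConjClasses G // ¬ IsRealClass C} := by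
    rw [numReal, ← Nat.card_sum]
    exact Nat.card_congr (Equiv.sumCompl _).symm
  rw [hreal, ← Nat.card_eq_fintype_card] at hmod
  unfold numComplexPairs
  unfold Nat.ModEq at hmod
  omega

end GroupReciprocity

/-!
The symbol `(·/G)` is a Dirichlet character modulo `|G|`. Let `p` be an odd prime not dividing
`|G|` and let `δ` be the determinant of the character table of `G` over an algebraically closed
field of characteristic `p`. By the orthogonality relations `δ ^ 2` is `(-1/G)` times the product
of the centralizer orders of all classes, which is `d` up to squares since a complex class and its
inverse have the same centralizer order. The Frobenius raises every character value to the `p`-th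
power, hence permutes the columns of the table by `g ↦ g ^ p`, so `δ ^ p = (p/G) δ`. By Euler's
criterion the two relations give `(p/G) = (d/p)`.

For odd `d`, quadratic reciprocity gives the remaining values. Since `|G|` divides `d`, both `(a/G)`
and `(a/|d|)` depend only on `a` modulo `d`. For positive `a ≡ 1` modulo `4` they agree, because
there `(a/G) = (d/a) = (a/|d|)`, so they agree for every integer `a`. As `(-1/G)` is the sign of
`d`, the case `a = -1` gives `d ≡ 1` modulo `4`, and then `a = 2` gives `(2/G) = (d/2)`.
-/

namespace GroupReciprocity

open NumberTheorySymbols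

section JacobiSymbol

theorem exists_prime_odd_factorization {n : ℕ} (hn : ¬ IsSquare n) :
    ∃ p, p.Prime ∧ Odd (n.factorization p) := by
  have hn0 : n ≠ 0 := by
    rintro rfl
    exact hn IsSquare.zero
  by_contra! h
  apply hn
  rw [← Nat.prod_factorization_pow_eq_self hn0]
  exact Finset.isSquare_prod _ fun p hp =>
    (Nat.not_odd_iff_even.1 (h p (Nat.prime_of_mem_primeFactors hp))).isSquare_pow p

theorem jacobiSym_eq_one_of_odd_of_modEq_one {r m : ℕ} (hr : Odd r) (hm : m % 4 = 1)
    (h : m ≡ 1 [MOD r]) : J(r | m) = 1 := by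
  rw [jacobiSym.quadratic_reciprocity_one_mod_four' hr hm, jacobiSym.mod_left' (a₂ := 1),
    jacobiSym.one_left]
  exact_mod_cast h

theorem jacobiSym_two_of_mod_eight_eq_one {m : ℕ} (hm : m % 8 = 1) : J(2 | m) = 1 := by
  rw [jacobiSym.at_two (Nat.odd_iff.2 (by lia)), ZMod.χ₈_nat_eq_if_mod_eight]
  simp [hm, show m % 2 ≠ 0 by lia]

theorem jacobiSym_two_of_mod_eight_eq_five {m : ℕ} (hm : m % 8 = 5) : J(2 | m) = -1 := by
  rw [jacobiSym.at_two (Nat.odd_iff.2 (by lia)), ZMod.χ₈_nat_eq_if_mod_eight]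
  simp [hm, show m % 2 ≠ 0 by lia]

theorem jacobiSym_eq_one_of_modEq_one {r m : ℕ} (hr : r ≠ 0) (h : m ≡ 1 [MOD 8 * r]) :
    J(r | m) = 1 := by
  obtain ⟨k, n, hn, rfl⟩ := Nat.exists_eq_two_pow_mul_odd hr
  have hm8 : m % 8 = 1 := h.of_mul_right _
  have hmn : m ≡ 1 [MOD n] := (h.of_mul_left 8).of_mul_left _
  push_cast
  rw [jacobiSym.mul_left, jacobiSym.pow_left, jacobiSym_two_of_mod_eight_eq_one hm8, one_pow,
    one_mul, jacobiSym_eq_one_of_odd_of_modEq_one hn (by lia) hmn]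

theorem exists_jacobiSym_two_pow_mul_eq_neg_one {j r : ℕ} (hj : Odd j) (hr : Odd r) :
    ∃ m : ℕ, Odd m ∧ J((2 ^ j * r : ℕ) | m) = -1 := by
  have hcop : Nat.Coprime 8 r := Nat.Coprime.pow_left 3 (Nat.coprime_two_left.2 hr)
  obtain ⟨m, (hm8 : m % 8 = 5), hmr⟩ := Nat.chineseRemainder hcop 5 1
  refine ⟨m, Nat.odd_iff.2 (by lia), ?_⟩
  push_cast
  rw [jacobiSym.mul_left, jacobiSym.pow_left, jacobiSym_two_of_mod_eight_eq_five hm8,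
    hj.neg_one_pow, jacobiSym_eq_one_of_odd_of_modEq_one hr (by lia) hmr, mul_one]

theorem exists_jacobiSym_prime_pow_mul_eq_neg_one {q j r : ℕ} (hq : q.Prime) (hq2 : q ≠ 2)
    (hj : Odd j) (hr : r ≠ 0) (hqr : ¬ q ∣ r) :
    ∃ m : ℕ, Odd m ∧ J((q ^ j * r : ℕ) | m) = -1 := by
  have : Fact q.Prime := ⟨hq⟩
  have hqo : Odd q := hq.odd_of_ne_two hq2
  have hcop : Nat.Coprime (8 * r) q :=
    Nat.Coprime.mul_left (Nat.Coprime.pow_left 3 (Nat.coprime_two_left.2 hqo))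
      ((Nat.Prime.coprime_iff_not_dvd hq).2 hqr).symm
  obtain ⟨u, hu⟩ := FiniteField.exists_nonsquare (F := ZMod q) (by rwa [ZMod.ringChar_zmod_n])
  obtain ⟨m, hmr, hmq⟩ := Nat.chineseRemainder hcop 1 u.val
  have hm8 : m % 8 = 1 := hmr.of_mul_right r
  have hmu : (m : ZMod q) = u := by
    rw [(ZMod.natCast_eq_natCast_iff _ _ _).2 hmq, ZMod.natCast_zmod_val]
  have hJq : J(q | m) = -1 := by
    rwa [jacobiSym.quadratic_reciprocity_one_mod_four' hqo (by lia),
      ← jacobiSym.legendreSym.to_jacobiSym, legendreSym.eq_neg_one_iff', hmu]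
  refine ⟨m, Nat.odd_iff.2 (by lia), ?_⟩
  push_cast
  rw [jacobiSym.mul_left, jacobiSym.pow_left, hJq, hj.neg_one_pow,
    jacobiSym_eq_one_of_modEq_one hr hmr, mul_one]

theorem exists_jacobiSym_eq_neg_one {d : ℕ} (hd : ¬ IsSquare d) :
    ∃ m : ℕ, Odd m ∧ J(d | m) = -1 := by
  obtain ⟨q, hq, hj⟩ := exists_prime_odd_factorization hd
  have hd0 : d ≠ 0 := by
    rintro rfl
    exact hd IsSquare.zero
  have hqr : ¬ q ∣ d / q ^ d.factorization q := Nat.not_dvd_ordCompl hq hd0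
  rw [← Nat.ordProj_mul_ordCompl_eq_self d q]
  rcases eq_or_ne q 2 with rfl | hq2
  · exact exists_jacobiSym_two_pow_mul_eq_neg_one hj
      (Nat.odd_iff.2 (Nat.two_dvd_ne_zero.1 hqr))
  · exact exists_jacobiSym_prime_pow_mul_eq_neg_one hq hq2 hj (Nat.ordCompl_pos q hd0).ne' hqr

theorem jacobiSym_eq_jacobiSym_natAbs {d : ℤ} (hd : Odd d) {m : ℕ} (hm : m % 4 = 1) :
    J(d | m) = J(m | d.natAbs) := by
  rw [← jacobiSym.quadratic_reciprocity_one_mod_four' hd.natAbs hm]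
  rcases Int.natAbs_eq d with h | h
  · rw [← h]
  · conv_lhs => rw [h]
    rw [jacobiSym.neg _ (Nat.odd_iff.2 (by lia)), ZMod.χ₄_nat_one_mod_four hm, one_mul]

theorem kroneckerPrime_eq_zero_of_dvd {d : ℤ} {p : ℕ} (hp : p.Prime) (h : (p : ℤ) ∣ d) :
    kroneckerPrime d p = 0 := by
  have : Fact p.Prime := ⟨hp⟩
  rcases eq_or_ne p 2 with rfl | hp2
  · exact if_pos (Int.emod_eq_zero_of_dvd h)
  · rwa [kroneckerPrime, if_neg hp2, ← jacobiSym.legendreSym.to_jacobiSym,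
      legendreSym.eq_zero_iff, ZMod.intCast_zmod_eq_zero_iff_dvd]

end JacobiSymbol

section KroneckerCharacter

/-- The character `χ` modulo `n` has the values of the Kronecker symbol `(d/·)` at `-1` and at the
odd primes. The condition `n ∣ d` makes `χ a` depend only on `a` modulo `d`, and together with
the parity condition it makes `χ` and `(d/·)` vanish at `2` simultaneously. -/
structure IsKroneckerAwayFromTwo {n : ℕ} (χ : DirichletCharacter ℤ n) (d : ℤ) : Prop where
  dvd : (n : ℤ) ∣ d
  even_of_even : Even d → Even n
  neg_one : χ (-1) = d.sign
  odd_prime : ∀ p : ℕ, p.Prime → p ≠ 2 → χ p = J(d | p)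

namespace IsKroneckerAwayFromTwo

variable {n : ℕ} {χ : DirichletCharacter ℤ n} {d : ℤ}

theorem ne_zero (h : IsKroneckerAwayFromTwo χ d) : d ≠ 0 := by
  have hunit : χ (-1) ≠ 0 := MulChar.apply_ne_zero_iff.2 isUnit_one.neg
  rwa [h.neg_one, ne_eq, Int.sign_eq_zero_iff_zero] at hunit

theorem map_natCast_of_odd (h : IsKroneckerAwayFromTwo χ d) {m : ℕ} (hm : Odd m) :
    χ m = J(d | m) := by
  induction m using Nat.recOnMul with
  | zero => simp at hm
  | one => simp
  | prime p hp => exact h.odd_prime p hp fun hp2 => absurd hm (by rw [hp2]; decide)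
  | mul a b iha ihb =>
    obtain ⟨ha, hb⟩ := Nat.odd_mul.1 hm
    rw [Nat.cast_mul, map_mul, iha ha, ihb hb, jacobiSym.mul_right' _ ha.pos.ne' hb.pos.ne']

/-- Reciprocity: both sides only depend on `b` modulo `d`, so `b` may be taken to be a natural
number that is `1` modulo `4`. -/
theorem map_intCast (h : IsKroneckerAwayFromTwo χ d) (hd : Odd d) (b : ℤ) :
    χ b = J(b | d.natAbs) := by
  have hcop : Nat.Coprime 4 d.natAbs :=
    Nat.Coprime.pow_left 2 (Nat.coprime_two_left.2 hd.natAbs)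
  obtain ⟨m, (hm4 : m % 4 = 1), hmb⟩ := Nat.chineseRemainder hcop 1 (b % d.natAbs).toNat
  have hmod : (m : ℤ) ≡ b [ZMOD d.natAbs] := by
    have hnonneg : 0 ≤ b % d.natAbs := Int.emod_nonneg b (mod_cast Int.natAbs_ne_zero.2 h.ne_zero)
    have := Int.natCast_modEq_iff.2 hmb
    rw [Int.toNat_of_nonneg hnonneg] at this
    exact this.trans (Int.mod_modEq b _)
  have hχ : χ m = χ b := by
    rw [← Int.cast_natCast, (ZMod.intCast_eq_intCast_iff _ _ _).2
      (hmod.of_dvd (Int.dvd_natAbs.2 h.dvd))]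
  rw [← hχ, h.map_natCast_of_odd (Nat.odd_iff.2 (by lia)),
    jacobiSym_eq_jacobiSym_natAbs hd hm4, jacobiSym.mod_left' hmod]

theorem emod_four_eq_one (h : IsKroneckerAwayFromTwo χ d) (hd : Odd d) : d % 4 = 1 := by
  have hsign : d.sign = ZMod.χ₄ d.natAbs := by
    rw [← jacobiSym.at_neg_one hd.natAbs, ← h.map_intCast hd, ← h.neg_one, Int.cast_neg,
      Int.cast_one]
  rcases Nat.odd_mod_four_iff.1 (Nat.odd_iff.1 hd.natAbs) with h4 | h4
  · rw [ZMod.χ₄_nat_one_mod_four h4, Int.sign_eq_one_iff_pos] at hsign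
    lia
  · rw [ZMod.χ₄_nat_three_mod_four h4, Int.sign_eq_neg_one_iff_neg] at hsign
    lia

theorem map_two (h : IsKroneckerAwayFromTwo χ d) (hd : Odd d) :
    χ 2 = kroneckerPrime d 2 := by
  have h4 := h.emod_four_eq_one hd
  have hχ₈ : χ 2 = ZMod.χ₈ d.natAbs := by
    rw [← jacobiSym.at_two hd.natAbs, ← h.map_intCast hd]
    simp
  rw [hχ₈, ZMod.χ₈_nat_eq_if_mod_eight, kroneckerPrime, if_pos rfl,
    if_neg (show d.natAbs % 2 ≠ 0 by lia), if_neg (show d % 2 ≠ 0 by lia)]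
  exact if_congr (by lia) rfl rfl

theorem map_prime (h : IsKroneckerAwayFromTwo χ d) {p : ℕ} (hp : p.Prime) :
    χ p = kroneckerPrime d p := by
  rcases eq_or_ne p 2 with rfl | hp2
  · rcases Int.even_or_odd d with hd | hd
    · have hχ : χ (2 : ℕ) = 0 := MulChar.map_nonunit χ fun hu =>
        (Nat.prime_two.coprime_iff_not_dvd.1 ((ZMod.isUnit_iff_coprime _ _).1 hu))
          (h.even_of_even hd).two_dvd
      rw [hχ, kroneckerPrime_eq_zero_of_dvd hp (by exact_mod_cast hd.two_dvd)]
    · exact_mod_cast h.map_two hd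
  · rw [h.odd_prime p hp hp2, kroneckerPrime, if_neg hp2]

theorem map_natCast (h : IsKroneckerAwayFromTwo χ d) {m : ℕ} (hm : m ≠ 0) :
    χ m = (m.primeFactorsList.map (kroneckerPrime d)).prod := by
  conv_lhs => rw [← Nat.prod_primeFactorsList hm, Nat.cast_list_prod, map_list_prod, List.map_map]
  exact congrArg List.prod
    (List.map_congr_left fun p hp => h.map_prime (Nat.prime_of_mem_primeFactorsList hp))

theorem modulus_eq_one_iff (h : IsKroneckerAwayFromTwo χ d) : n = 1 ↔ d = 1 ∨ d = -1 := by
  rw [← Int.isUnit_iff]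
  refine ⟨?_, fun hd => ?_⟩
  · rintro rfl
    by_contra hd
    obtain ⟨p, hp, hpd⟩ := Int.exists_prime_and_dvd (mt Int.isUnit_iff_natAbs_eq.2 hd)
    have hχ : χ p.natAbs = 1 := by rw [Subsingleton.elim (p.natAbs : ZMod 1) 1, map_one]
    rw [h.map_prime (Int.prime_iff_natAbs_prime.1 hp), kroneckerPrime_eq_zero_of_dvd
      (Int.prime_iff_natAbs_prime.1 hp) (Int.natAbs_dvd.2 hpd)] at hχ
    exact zero_ne_one hχ
  · simpa using Int.isUnit_iff_natAbs_eq.1 (isUnit_of_dvd_unit h.dvd hd)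

theorem map_zero (h : IsKroneckerAwayFromTwo χ d) : χ 0 = kroneckerSym d 0 := by
  rw [kroneckerSym, if_pos rfl, ← if_congr h.modulus_eq_one_iff rfl rfl]
  split_ifs with hn
  · subst hn
    rw [Subsingleton.elim (0 : ZMod 1) 1, map_one]
  · have : Nontrivial (ZMod n) := ZMod.nontrivial_iff.2 hn
    exact χ.map_zero

theorem eq_kroneckerSym (h : IsKroneckerAwayFromTwo χ d) (a : ℤ) : χ a = kroneckerSym d a := by
  rcases eq_or_ne a 0 with rfl | ha
  · exact_mod_cast h.map_zero
  have habs := h.map_natCast (Int.natAbs_ne_zero.2 ha)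
  rw [kroneckerSym, if_neg ha, ← habs]
  rcases ha.lt_or_gt with hneg | hpos
  · have hsign : d.sign = if a < 0 ∧ d < 0 then -1 else 1 := by
      rcases h.ne_zero.lt_or_gt with hd | hd
      · simp [hneg, hd, Int.sign_eq_neg_one_of_neg]
      · simp [hd.not_gt, Int.sign_eq_one_of_pos hd]
    have hcast : (a : ZMod n) = -1 * (a.natAbs : ZMod n) := by
      rw [← Int.cast_natCast, Int.ofNat_natAbs_of_nonpos hneg.le]
      simp
    rw [hcast, map_mul, h.neg_one, hsign]
  · rw [if_neg fun hc => hpos.not_gt hc.1, one_mul, ← Int.cast_natCast,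
      Int.natAbs_of_nonneg hpos.le]

/-- For the converse, Dirichlet's theorem represents every unit modulo `n` by an odd prime. -/
theorem eq_one_iff (h : IsKroneckerAwayFromTwo χ d) : χ = 1 ↔ IsSquare d := by
  refine ⟨fun hχ => ?_, ?_⟩
  · have hpos : 0 < d := by
      rw [← Int.sign_eq_one_iff_pos, ← h.neg_one, hχ, MulChar.one_apply isUnit_one.neg]
    lift d to ℕ using hpos.le
    by_contra hd
    obtain ⟨m, hm, hJ⟩ := exists_jacobiSym_eq_neg_one fun hs => hd (hs.map (Nat.castRingHom ℤ))
    rw [← h.map_natCast_of_odd hm, hχ] at hJ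
    by_cases hu : IsUnit (m : ZMod n)
    · simp [MulChar.one_apply hu] at hJ
    · simp [MulChar.map_nonunit _ hu] at hJ
  · rintro ⟨s, rfl⟩
    have : NeZero n := ⟨by rintro rfl; exact h.ne_zero (zero_dvd_iff.1 (mod_cast h.dvd))⟩
    refine MulChar.eq_one_iff.2 fun u => ?_
    obtain ⟨p, hp2, hp, hpu⟩ := Nat.forall_exists_prime_gt_and_eq_mod u.isUnit 2
    have hχ : χ u = J(s | p) * J(s | p) := by
      rw [← hpu, h.odd_prime p hp hp2.ne', jacobiSym.mul_left]
    have hne : χ u ≠ 0 := MulChar.apply_ne_zero_iff.2 u.isUnit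
    rcases jacobiSym.trichotomy s p with hJ | hJ | hJ <;> simp_all

end IsKroneckerAwayFromTwo

end KroneckerCharacter

section TracePower

open Polynomial

variable {n R : Type*} [Fintype n] [DecidableEq n] [CommRing R] (p : ℕ) [Fact p.Prime] [CharP R p]

theorem mapMatrix_expand_charmatrix_pow_char [Nonempty n] (M : Matrix n n R) :
    (expand R p).mapMatrix (M ^ p).charmatrix = M.charmatrix ^ p := by
  have hcomm : Commute (Matrix.scalar n (X : R[X])) (C.mapMatrix M) :=
    Matrix.scalar_commute _ (Commute.all _) _
  rw [Matrix.charmatrix, Matrix.charmatrix, sub_pow_char_of_commute _ hcomm, map_sub,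
    ← map_pow, ← map_pow]
  congr 1
  · ext i j : 1
    by_cases hij : i = j <;> simp [Matrix.scalar_apply, hij]
  · ext i j : 1
    simp

theorem expand_charpoly_pow_char [Nonempty n] (M : Matrix n n R) :
    expand R p (M ^ p).charpoly = M.charpoly ^ p := by
  rw [Matrix.charpoly, AlgHom.map_det, mapMatrix_expand_charmatrix_pow_char, Matrix.det_pow,
    Matrix.charpoly]

theorem charpoly_pow_char [Nonempty n] (M : Matrix n n R) :
    (M ^ p).charpoly = M.charpoly.map (frobenius R p) := by
  apply expand_injective (R := R) (Fact.out : p.Prime).pos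
  rw [expand_charpoly_pow_char, ← map_frobenius_expand, map_expand]

theorem trace_pow_char (M : Matrix n n R) : (M ^ p).trace = M.trace ^ p := by
  cases isEmpty_or_nonempty n
  · simp [Matrix.trace, (Fact.out : p.Prime).ne_zero]
  · rw [Matrix.trace_eq_neg_charpoly_coeff, Matrix.trace_eq_neg_charpoly_coeff,
      charpoly_pow_char, coeff_map, ← frobenius_def, map_neg]

end TracePower

section EulerCriterion

theorem legendreSym_eq_of_sq_eq {p : ℕ} [Fact p.Prime] (hp : p ≠ 2) {K : Type*} [Field K]
    [CharP K p] {D : ℤ} {ε : ℤˣ} {δ : K} (hδ₀ : δ ≠ 0) (hδ : δ ^ 2 = D)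
    (hfrob : δ ^ p = (ε : ℤ) * δ) : legendreSym p D = ε := by
  have hD : (D : ZMod p) ≠ 0 := by
    rw [Ne, CharP.intCast_eq_zero_iff (ZMod p) p, ← CharP.intCast_eq_zero_iff K p, ← hδ]
    exact pow_ne_zero 2 hδ₀
  have hodd : p % 2 = 1 := (Fact.out : p.Prime).mod_two_eq_one_iff_ne_two.2 hp
  have hε : (legendreSym p D : K) = (ε : ℤ) := by
    apply mul_right_cancel₀ hδ₀
    have hleg := congrArg (ZMod.castHom dvd_rfl K) (legendreSym.eq_pow p D)
    rw [map_intCast, map_pow, map_intCast] at hleg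
    rw [hleg, ← hδ, ← hfrob, ← pow_mul, ← pow_succ, Nat.two_mul_odd_div_two hodd]
    congr 1
    have := (Fact.out : p.Prime).pos
    lia
  have hne : (-1 : K) ≠ 1 :=
    Ring.neg_one_ne_one_of_char_ne_two (by rwa [ringChar.eq K p])
  rcases legendreSym.eq_one_or_neg_one p hD with h | h <;>
    rcases Int.units_eq_one_or ε with rfl | rfl <;> simp_all [hne.symm]

end EulerCriterion

section TwoSidedTrace

theorem trace_mulLeft_mulRight_pi_matrix {ι R : Type*} [Fintype ι] [CommRing R]
    {m : ι → Type*} [∀ i, Fintype (m i)] (A B : Π i, Matrix (m i) (m i) R) :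
    LinearMap.trace R _ (LinearMap.mulLeft R A ∘ₗ LinearMap.mulRight R B) =
      ∑ i, (A i).trace * (B i).trace := by
  classical
  rw [LinearMap.trace_eq_matrix_trace R (Pi.basis fun i => Matrix.stdBasis R (m i) (m i))]
  simp only [Matrix.trace, Matrix.diag_apply, LinearMap.toMatrix_apply, Fintype.sum_sigma,
    Fintype.sum_prod_type, Finset.sum_mul_sum]
  refine Finset.sum_congr rfl fun i _ => Finset.sum_congr rfl fun a _ =>
    Finset.sum_congr rfl fun b _ => ?_
  have hrepr (M : Matrix (m i) (m i) R) :
      (Matrix.stdBasis R (m i) (m i)).repr M (a, b) = M a b := by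
    simp [Matrix.stdBasis]
  have hentry : (A i * Matrix.single a b 1 * B i : Matrix (m i) (m i) R) a b =
      A i a a * B i b b := by
    rw [Matrix.mul_apply, Finset.sum_eq_single b] <;> simp +contextual
  rw [Pi.basis_repr, hrepr, Pi.basis_apply, Matrix.stdBasis_eq_single]
  simpa only [LinearMap.comp_apply, LinearMap.mulLeft_apply, LinearMap.mulRight_apply,
    Pi.mul_apply, Pi.single_eq_same, ← mul_assoc] using hentry

theorem trace_mulLeft_mulRight_monoidAlgebra (R : Type*) {G : Type*} [CommRing R] [Monoid G]
    [Finite G] (g h : G) :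
    LinearMap.trace R _ (LinearMap.mulLeft R (MonoidAlgebra.single g (1 : R)) ∘ₗ
      LinearMap.mulRight R (MonoidAlgebra.single h (1 : R))) =
      (Nat.card {x : G // g * x * h = x} : R) := by
  classical
  have : Fintype G := Fintype.ofFinite G
  rw [LinearMap.trace_eq_matrix_trace R (MonoidAlgebra.basis G R)]
  simp only [Matrix.trace, Matrix.diag_apply, LinearMap.toMatrix_apply]
  simp [MonoidAlgebra.basis, MonoidAlgebra.single_mul_single, Finsupp.single_apply,
    Fintype.card_subtype, mul_assoc]

end TwoSidedTrace

section ClassPowers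

theorem isUnit_intCast_zmod_iff {n : ℕ} {a : ℤ} : IsUnit (a : ZMod n) ↔ Int.gcd a n = 1 := by
  rw [ZMod.coe_int_isUnit_iff_isCoprime, isCoprime_comm, Int.isCoprime_iff_gcd_eq_one]

theorem gcd_neg_one_left (n : ℤ) : Int.gcd (-1) n = 1 := by simp

variable {G : Type*} [Group G]

theorem classPow_mul (a b : ℤ) (C : ConjClasses G) :
    classPow (a * b) C = classPow a (classPow b C) := by
  obtain ⟨g, rfl⟩ := ConjClasses.exists_rep C
  rw [classPow_mk, classPow_mk, classPow_mk, mul_comm, zpow_mul]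

theorem classPow_one (C : ConjClasses G) : classPow 1 C = C := by
  obtain ⟨g, rfl⟩ := ConjClasses.exists_rep C
  rw [classPow_mk, zpow_one]

theorem classPow_congr {a b : ℤ} (h : a ≡ b [ZMOD Nat.card G]) (C : ConjClasses G) :
    classPow a C = classPow b C := by
  obtain ⟨g, rfl⟩ := ConjClasses.exists_rep C
  rw [classPow_mk, classPow_mk, zpow_eq_zpow_iff_modEq.2
    (h.of_dvd (Int.natCast_dvd_natCast.2 (orderOf_dvd_natCard g)))]

theorem isRealClass_mk_of_inv_eq {g : G} (hg : g⁻¹ = g) : IsRealClass (ConjClasses.mk g) := by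
  rw [isRealClass_iff, classPow_mk, zpow_neg_one, hg]

theorem prod_not_isRealClass_eq_one [Fintype (ConjClasses G)]
    [DecidablePred (IsRealClass (G := G))] {M : Type*} [CommMonoid M] {f : ConjClasses G → M}
    (hf : ∀ C, f C * f (classPow (-1) C) = 1) :
    ∏ C : ConjClasses G with ¬ IsRealClass C, f C = 1 := by
  refine Finset.prod_involution (fun C _ => classPow (-1) C) (fun C _ => hf C) ?_ ?_
    fun C _ => classPow_classPow_neg_one C
  · exact fun C hC _ h => (Finset.mem_filter.1 hC).2 ((isRealClass_iff C).2 h)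
  · intro C hC
    simpa [isRealClass_iff, classPow_classPow_neg_one, eq_comm] using hC

variable (G) in
/-- The action of `(ℤ / |G|)ˣ` on the conjugacy classes of `G` by powers. -/
noncomputable def classPowHom [Finite G] :
    (ZMod (Nat.card G))ˣ →* Equiv.Perm (ConjClasses G) where
  toFun u := classPerm (u : ZMod (Nat.card G)).val (ZMod.val_coe_unit_coprime u)
  map_one' := Equiv.ext fun C => by
    refine (classPow_congr ?_ C).trans (classPow_one C)
    rw [← ZMod.intCast_eq_intCast_iff]
    simp
  map_mul' u v := Equiv.ext fun C => by
    refine (classPow_congr ?_ C).trans (classPow_mul _ _ C)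
    rw [← ZMod.intCast_eq_intCast_iff]
    simp

variable (G) in
open Classical in
/-- The symbol `(·/G)` as a Dirichlet character modulo `|G|`. -/
noncomputable def quadChar [Finite G] : DirichletCharacter ℤ (Nat.card G) :=
  letI : Fintype (ConjClasses G) := Fintype.ofFinite _
  MulChar.ofUnitHom (Equiv.Perm.sign.comp (classPowHom G))

variable [Finite G]

theorem quadChar_intCast [Fintype (ConjClasses G)] [DecidableEq (ConjClasses G)] {a : ℤ}
    (h : Int.gcd a (Nat.card G) = 1) :
    quadChar G a = Equiv.Perm.sign (classPerm (G := G) a h) := by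
  obtain ⟨u, hu⟩ := isUnit_intCast_zmod_iff.2 h
  have hperm : classPowHom G u = classPerm a h := Equiv.ext fun C => by
    refine classPow_congr ?_ C
    rw [← ZMod.intCast_eq_intCast_iff, ← hu]
    simp
  rw [quadChar, ← hu, MulChar.ofUnitHom_coe, MonoidHom.comp_apply, hperm]
  congr!

theorem quadSym_eq_quadChar (a : ℤ) : quadSym G a = quadChar G a := by
  classical
  have : Fintype (ConjClasses G) := Fintype.ofFinite _
  by_cases h : Int.gcd a (Nat.card G) = 1
  · rw [quadChar_intCast h, quadSym, dif_pos h]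
    congr!
  · rw [MulChar.map_nonunit _ (mt isUnit_intCast_zmod_iff.1 h), quadSym, dif_neg h]

variable (G) in
theorem forall_quadSym_eq_one_iff :
    (∀ a : ℤ, Int.gcd a (Nat.card G) = 1 → quadSym G a = 1) ↔ quadChar G = 1 := by
  refine ⟨fun h => MulChar.eq_one_iff.2 fun u => ?_, fun h a ha => ?_⟩
  · obtain ⟨a, ha⟩ := ZMod.intCast_surjective (u : ZMod (Nat.card G))
    rw [← ha, ← quadSym_eq_quadChar, h a (isUnit_intCast_zmod_iff.1 (ha ▸ u.isUnit))]
  · rw [quadSym_eq_quadChar, h, MulChar.one_apply (isUnit_intCast_zmod_iff.2 ha)]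

theorem quadChar_neg_one : quadChar G (-1) = (-1) ^ numComplexPairs G := by
  classical
  have : Fintype (ConjClasses G) := Fintype.ofFinite _
  have hfix : Fintype.card (Function.fixedPoints (classPerm (-1) (gcd_neg_one_left (Nat.card G)))) =
      numReal G := by
    rw [numReal, ← Nat.card_eq_fintype_card]
    exact Nat.card_congr (Equiv.subtypeEquivRight fun C => (isRealClass_iff C).symm)
  have hinv : classPerm (-1) (gcd_neg_one_left (Nat.card G)) ^ 2 = 1 :=
    Equiv.ext classPow_classPow_neg_one
  have hchar := quadChar_intCast (gcd_neg_one_left (Nat.card G))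
  rw [Equiv.Perm.sign_of_pow_two_eq_one hinv, hfix, ← Nat.card_eq_fintype_card,
    card_conjClasses_eq, Nat.add_sub_cancel_left, Nat.mul_div_cancel_left _ two_pos] at hchar
  simpa using hchar

end ClassPowers

section Centralizers

variable {G : Type*} [Group G]

/-- The common order of the centralizers of the elements of the class `C`, encoded as the index
`|G| / |C|`, which is exact for finite `G`. -/
noncomputable def centralizerCard (C : ConjClasses G) : ℕ :=
  Nat.card G / C.carrier.ncard

theorem card_conjugators {g h : G} (hgh : IsConj g h) :
    Nat.card {x : G // x * g * x⁻¹ = h} = Nat.card (Subgroup.centralizer {g}) := by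
  obtain ⟨c, rfl⟩ := isConj_iff.1 hgh
  refine (Nat.card_congr ((Equiv.mulLeft c).subtypeEquiv fun x => ?_)).symm
  rw [Subgroup.mem_centralizer_singleton_iff, Equiv.coe_mulLeft, mul_inv_rev,
    ← mul_inv_eq_iff_eq_mul]
  simp only [mul_assoc, mul_right_inj]
  simp only [← mul_assoc, mul_left_inj]

theorem ncard_carrier_mul_card_centralizer (g : G) :
    (ConjClasses.mk g).carrier.ncard * Nat.card (Subgroup.centralizer {g}) = Nat.card G := by
  rw [Subgroup.nat_card_centralizer_nat_card_stabilizer, ← ConjAct.orbit_eq_carrier_conjClasses,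
    ← MulAction.index_stabilizer, mul_comm, Subgroup.card_mul_index]
  rfl

variable [Finite G]

theorem centralizerCard_mk (g : G) :
    centralizerCard (ConjClasses.mk g) = Nat.card (Subgroup.centralizer {g}) := by
  have h := ncard_carrier_mul_card_centralizer g
  rw [centralizerCard, ← h, Nat.mul_div_cancel_left]
  exact Nat.pos_of_ne_zero (left_ne_zero_of_mul (h ▸ Nat.card_pos.ne'))

theorem ncard_carrier_mul_centralizerCard (C : ConjClasses G) :
    C.carrier.ncard * centralizerCard C = Nat.card G := by
  obtain ⟨g, rfl⟩ := ConjClasses.exists_rep C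
  rw [centralizerCard_mk, ncard_carrier_mul_card_centralizer]

theorem centralizerCard_dvd_card (C : ConjClasses G) : centralizerCard C ∣ Nat.card G :=
  Dvd.intro_left _ (ncard_carrier_mul_centralizerCard C)

theorem centralizerCard_pos (C : ConjClasses G) : 0 < centralizerCard C :=
  Nat.pos_of_dvd_of_pos (centralizerCard_dvd_card C) Nat.card_pos

theorem centralizerCard_cast_ne_zero {R : Type*} [NonAssocSemiring R] [NeZero (Nat.card G : R)]
    (C : ConjClasses G) : (centralizerCard C : R) ≠ 0 := fun h => NeZero.ne (Nat.card G : R) (by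
  rw [← ncard_carrier_mul_centralizerCard C, Nat.cast_mul, h, mul_zero])

theorem centralizerCard_one : centralizerCard (ConjClasses.mk (1 : G)) = Nat.card G := by
  have htop : Subgroup.centralizer {(1 : G)} = ⊤ := by
    ext x
    simp [Subgroup.mem_centralizer_singleton_iff]
  rw [centralizerCard_mk, htop, Subgroup.card_top]

theorem centralizerCard_classPow_neg_one (C : ConjClasses G) :
    centralizerCard (classPow (-1) C) = centralizerCard C := by
  obtain ⟨g, rfl⟩ := ConjClasses.exists_rep C
  have hinv : Subgroup.centralizer {g⁻¹} = Subgroup.centralizer {g} := by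
    ext x
    simp only [Subgroup.mem_centralizer_singleton_iff]
    exact Commute.inv_right_iff
  rw [classPow_mk, zpow_neg_one, centralizerCard_mk, centralizerCard_mk, hinv]

theorem card_mul_mul_eq_self (g h : G) [DecidableEq (ConjClasses G)] :
    Nat.card {x : G // g * x * h = x} =
      if ConjClasses.mk h = classPow (-1) (ConjClasses.mk g) then
        centralizerCard (ConjClasses.mk g) else 0 := by
  have hiff (x : G) : g * x * h = x ↔ x * h * x⁻¹ = g⁻¹ := by
    rw [mul_assoc, ← eq_inv_mul_iff_mul_eq, mul_inv_eq_iff_eq_mul]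
  rw [Nat.card_congr (Equiv.subtypeEquivRight hiff), classPow_mk, zpow_neg_one]
  split_ifs with hgh
  · rw [card_conjugators (ConjClasses.mk_eq_mk_iff_isConj.1 hgh), ← centralizerCard_mk, hgh,
      ← zpow_neg_one, ← classPow_mk, centralizerCard_classPow_neg_one]
  · have : IsEmpty {x : G // x * h * x⁻¹ = g⁻¹} :=
      ⟨fun x => hgh (ConjClasses.mk_eq_mk_iff_isConj.2 (isConj_iff.2 ⟨x, x.2⟩))⟩
    exact Nat.card_of_isEmpty

end Centralizers

section CharacterTable

variable {G K ι : Type*} [Group G] [Field K] {m : ι → Type*} [∀ i, Fintype (m i)]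
  [∀ i, DecidableEq (m i)] (e : MonoidAlgebra K G ≃ₐ[K] Π i, Matrix (m i) (m i) K)

/-- The irreducible character of `G` afforded by the `i`-th block of a decomposition of the group
algebra into matrix algebras. -/
noncomputable def blockCharacter (i : ι) (g : G) : K :=
  (e (MonoidAlgebra.single g 1) i).trace

theorem blockCharacter_eq_of_isConj (i : ι) {g h : G} (hgh : IsConj g h) :
    blockCharacter e i g = blockCharacter e i h := by
  obtain ⟨c, rfl⟩ := isConj_iff.1 hgh
  have hmul (x y : G) : e (MonoidAlgebra.single (x * y) 1) i =
      e (MonoidAlgebra.single x 1) i * e (MonoidAlgebra.single y 1) i := by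
    rw [← Pi.mul_apply, ← map_mul, MonoidAlgebra.single_mul_single, mul_one]
  rw [blockCharacter, blockCharacter, hmul, Matrix.trace_mul_comm, ← hmul, inv_mul_cancel_left]

/-- The character table of `G`, with rows indexed by the blocks of the group algebra. -/
noncomputable def characterTable : Matrix ι (ConjClasses G) K := fun i =>
  Quotient.lift (blockCharacter e i) fun _ _ => blockCharacter_eq_of_isConj e i

theorem characterTable_mk (i : ι) (g : G) :
    characterTable e i (ConjClasses.mk g) = blockCharacter e i g := rfl

theorem characterTable_pow_char (p : ℕ) [Fact p.Prime] [CharP K p] (i : ι) (C : ConjClasses G) :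
    characterTable e i C ^ p = characterTable e i (classPow p C) := by
  obtain ⟨g, rfl⟩ := ConjClasses.exists_rep C
  have hpow : MonoidAlgebra.single (g ^ p) (1 : K) = MonoidAlgebra.single g 1 ^ p := by
    rw [MonoidAlgebra.single_pow, one_pow]
  rw [classPow_mk, zpow_natCast, characterTable_mk, characterTable_mk, blockCharacter,
    blockCharacter, ← trace_pow_char, hpow, map_pow, Pi.pow_apply]

theorem sum_mul_trace_eq_zero [Fintype ι] {c : ι → K}
    (hc : ∑ i, c i • characterTable e i = 0) (x : Π i, Matrix (m i) (m i) K) :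
    ∑ i, c i * (x i).trace = 0 := by
  obtain ⟨y, rfl⟩ := e.surjective x
  induction y using MonoidAlgebra.induction_linear with
  | zero => simp
  | add y z hy hz => simp [mul_add, Finset.sum_add_distrib, hy, hz]
  | single g a =>
    have hg : ∑ i, c i * blockCharacter e i g = 0 := by
      simpa [characterTable_mk] using congrFun hc (ConjClasses.mk g)
    have hsmul : MonoidAlgebra.single g a = a • MonoidAlgebra.single g (1 : K) := by simp
    calc ∑ i, c i * (e (MonoidAlgebra.single g a) i).trace
        = ∑ i, a * (c i * blockCharacter e i g) := by
          refine Finset.sum_congr rfl fun i _ => ?_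
          rw [hsmul, map_smul, Pi.smul_apply, Matrix.trace_smul, smul_eq_mul, mul_left_comm,
            blockCharacter]
      _ = 0 := by rw [← Finset.mul_sum, hg, mul_zero]

theorem linearIndependent_characterTable [Finite ι] [∀ i, Nonempty (m i)] :
    LinearIndependent K (characterTable e).row := by
  classical
  have : Fintype ι := Fintype.ofFinite ι
  refine Fintype.linearIndependent_iff.2 fun c hc i => ?_
  let a : m i := Classical.arbitrary _
  have h := sum_mul_trace_eq_zero e hc (Pi.single i (Matrix.single a a 1))
  rw [Finset.sum_eq_single i (fun j _ hj => by simp [Pi.single_eq_of_ne hj]) (by simp)] at h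
  simpa using h

variable [Finite G] [Fintype ι]

/-- Both sides are the trace of `x ↦ g * x * h` on the group algebra, computed in the basis of
matrix units and in the basis `G`. -/
theorem sum_blockCharacter_mul (g h : G) :
    ∑ i, blockCharacter e i g * blockCharacter e i h = (Nat.card {x : G // g * x * h = x} : K) := by
  simp only [blockCharacter]
  rw [← trace_mulLeft_mulRight_monoidAlgebra, ← trace_mulLeft_mulRight_pi_matrix,
    ← LinearMap.trace_conj' _ e.toLinearEquiv]
  congr 1
  refine LinearMap.ext fun x => ?_
  simp [LinearEquiv.conj_apply]

variable [Fintype (ConjClasses G)] [DecidableEq (ConjClasses G)]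

theorem transpose_mul_characterTable :
    (characterTable e).transpose * characterTable e =
      Matrix.diagonal (fun C => (centralizerCard C : K)) *
        (classPerm (-1) (gcd_neg_one_left (Nat.card G))).permMatrix K := by
  ext C D
  obtain ⟨g, rfl⟩ := ConjClasses.exists_rep C
  obtain ⟨h, rfl⟩ := ConjClasses.exists_rep D
  simp only [Matrix.mul_apply, Matrix.transpose_apply, characterTable_mk]
  rw [sum_blockCharacter_mul, card_mul_mul_eq_self, ← Matrix.mul_apply, Matrix.diagonal_mul]
  simp only [Equiv.Perm.permMatrix, PEquiv.toMatrix_apply, Equiv.toPEquiv_apply, Option.mem_def,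
    Option.some_inj, mul_ite, mul_one, mul_zero, Nat.cast_ite, Nat.cast_zero]
  exact if_congr eq_comm rfl rfl

theorem det_transpose_mul_characterTable :
    ((characterTable e).transpose * characterTable e).det =
      ((quadChar G (-1) * ∏ C : ConjClasses G, (centralizerCard C : ℤ) : ℤ) : K) := by
  have hchar := quadChar_intCast (gcd_neg_one_left (Nat.card G))
  rw [Int.cast_neg, Int.cast_one] at hchar
  rw [transpose_mul_characterTable, Matrix.det_mul, Matrix.det_diagonal, Matrix.det_permutation,
    mul_comm, hchar]
  push_cast
  rfl

end CharacterTable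

theorem card_conjClasses_eq_card_blocks {G K ι : Type*} [Group G] [Finite G]
    [Fintype (ConjClasses G)] [Field K] [NeZero (Nat.card G : K)] [Fintype ι] {m : ι → Type*}
    [∀ i, Fintype (m i)] [∀ i, DecidableEq (m i)] [∀ i, Nonempty (m i)]
    (e : MonoidAlgebra K G ≃ₐ[K] Π i, Matrix (m i) (m i) K) :
    Fintype.card (ConjClasses G) = Fintype.card ι := by
  classical
  apply le_antisymm
  · have hunit : IsUnit ((characterTable e).transpose * characterTable e) := by
      rw [transpose_mul_characterTable, Matrix.isUnit_iff_isUnit_det, Matrix.det_mul,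
        Matrix.det_diagonal, Matrix.det_permutation]
      refine (Finset.prod_ne_zero_iff.2 fun C _ => centralizerCard_cast_ne_zero C).isUnit.mul ?_
      exact (Units.isUnit _).map (Int.castRingHom K)
    calc Fintype.card (ConjClasses G)
        = ((characterTable e).transpose * characterTable e).rank :=
          (Matrix.rank_of_isUnit _ hunit).symm
      _ ≤ (characterTable e).rank := Matrix.rank_mul_le_right _ _
      _ ≤ Fintype.card ι := Matrix.rank_le_card_height _
  · simpa using (linearIndependent_characterTable e).fintype_card_le_finrank

section DeterminantRoot

variable {G : Type*} [Group G] [Finite G]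

theorem exists_sq_eq_prod_centralizerCard (K : Type*) [Field K] [IsAlgClosed K] (p : ℕ)
    [Fact p.Prime] [CharP K p] (hgcd : Int.gcd p (Nat.card G) = 1) [Fintype (ConjClasses G)]
    [DecidableEq (ConjClasses G)] :
    ∃ δ : K, δ ^ 2 = ((quadChar G (-1) * ∏ C : ConjClasses G, (centralizerCard C : ℤ) : ℤ) : K) ∧
      δ ^ p = ((Equiv.Perm.sign (classPerm (G := G) p hgcd) : ℤ) : K) * δ := by
  have : Fintype G := Fintype.ofFinite G
  have : NeZero (Nat.card G : K) := ⟨fun h => (Fact.out : p.Prime).coprime_iff_not_dvd.1 hgcd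
    ((CharP.cast_eq_zero_iff K p _).1 h)⟩
  obtain ⟨n, m, _, ⟨e⟩⟩ :=
    IsSemisimpleRing.exists_algEquiv_pi_matrix_of_isAlgClosed K (MonoidAlgebra K G)
  let f : ConjClasses G ≃ Fin n := Fintype.equivOfCardEq (card_conjClasses_eq_card_blocks e)
  let X : Matrix (ConjClasses G) (ConjClasses G) K := (characterTable e).submatrix f id
  refine ⟨X.det, ?_, ?_⟩
  · have hX : X.transpose * X = (characterTable e).transpose * characterTable e := by
      rw [Matrix.transpose_submatrix, Matrix.submatrix_mul_equiv, Matrix.submatrix_id_id]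
    rw [← det_transpose_mul_characterTable e, ← hX, Matrix.det_mul, Matrix.det_transpose, sq]
  · rw [← Matrix.det_permute', ← frobenius_def, RingHom.map_det]
    congr 1
    ext C D
    exact characterTable_pow_char e p (f C) D

end DeterminantRoot

section Discriminant

variable (G : Type*) [Group G]

/-- The discriminant of `G` as an integer, each factor `|G| * |C|⁻¹` of `groupDisc` being written
as the order of a centralizer. -/
noncomputable def intDisc : ℤ :=
  (-1) ^ numComplexPairs G *
    ∏ᶠ C : {C : ConjClasses G // IsRealClass C}, (centralizerCard C.1 : ℤ)

variable [Finite G]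

theorem intDisc_cast : (intDisc G : ℚ) = groupDisc G := by
  have : Fintype {C : ConjClasses G // IsRealClass C} := Fintype.ofFinite _
  have hfactor (C : ConjClasses G) :
      (centralizerCard C : ℚ) = Nat.card G * (C.carrier.ncard : ℚ)⁻¹ := by
    have h := ncard_carrier_mul_centralizerCard C
    have h₀ : (C.carrier.ncard : ℚ) ≠ 0 :=
      Nat.cast_ne_zero.2 (left_ne_zero_of_mul (h ▸ Nat.card_pos.ne'))
    rw [← h, Nat.cast_mul, mul_comm, inv_mul_cancel_left₀ h₀]
  rw [intDisc, groupDisc, finprod_eq_prod_of_fintype, finprod_eq_prod_of_fintype, numReal,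
    Nat.card_eq_fintype_card (α := {C : ConjClasses G // IsRealClass C}), ← Finset.card_univ,
    mul_assoc, ← Finset.prod_const, ← Finset.prod_mul_distrib]
  push_cast
  simp only [hfactor]

theorem intDisc_eq_prod [Fintype (ConjClasses G)] [DecidablePred (IsRealClass (G := G))] :
    intDisc G = quadChar G (-1) * ∏ C : ConjClasses G with IsRealClass C,
      (centralizerCard C : ℤ) := by
  have hsubtype := Finset.prod_subtype (p := IsRealClass) (F := inferInstance)
    (Finset.univ.filter fun C : ConjClasses G => IsRealClass C)
    (fun _ => Finset.mem_filter_univ _) fun C => (centralizerCard C : ℤ)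
  rw [intDisc, finprod_eq_prod_of_fintype, quadChar_neg_one, hsubtype]

variable {G}

theorem centralizerCard_dvd_intDisc {C : ConjClasses G} (hC : IsRealClass C) :
    (centralizerCard C : ℤ) ∣ intDisc G := by
  classical
  have : Fintype (ConjClasses G) := Fintype.ofFinite _
  rw [intDisc_eq_prod]
  exact (Finset.dvd_prod_of_mem _ (by simpa using hC)).mul_left _

variable (G) in
theorem card_dvd_intDisc : (Nat.card G : ℤ) ∣ intDisc G := by
  rw [← centralizerCard_one]
  exact centralizerCard_dvd_intDisc (isRealClass_mk_of_inv_eq inv_one)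

theorem orderOf_dvd_centralizerCard {g h : G} (hgh : Commute g h) :
    orderOf g ∣ centralizerCard (ConjClasses.mk h) := by
  rw [centralizerCard_mk]
  exact Subgroup.orderOf_dvd_natCard _ (Subgroup.mem_centralizer_singleton_iff.2 hgh)

/-- The classes of `1` and of an involution are real and each contribute a factor of `2`. -/
theorem four_dvd_intDisc (hG : Even (Nat.card G)) : 4 ∣ intDisc G := by
  classical
  have : Fintype (ConjClasses G) := Fintype.ofFinite _
  have : Fact (Nat.Prime 2) := ⟨Nat.prime_two⟩
  obtain ⟨t, ht⟩ := exists_prime_orderOf_dvd_card' 2 hG.two_dvd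
  have htinv : t⁻¹ = t := by rw [inv_eq_iff_mul_eq_one, ← sq, ← ht, pow_orderOf_eq_one]
  have hne : ConjClasses.mk t ≠ ConjClasses.mk 1 := by
    rw [Ne, ConjClasses.mk_eq_mk_iff_isConj, isConj_one_left]
    rintro rfl
    simp at ht
  have hpair : ∏ C ∈ {ConjClasses.mk t, ConjClasses.mk (1 : G)}, (centralizerCard C : ℤ) ∣
      intDisc G := by
    rw [intDisc_eq_prod]
    refine (Finset.prod_dvd_prod_of_subset _ _ _ ?_).mul_left _
    simp [Finset.insert_subset_iff, isRealClass_mk_of_inv_eq htinv,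
      isRealClass_mk_of_inv_eq (inv_one (G := G))]
  rw [Finset.prod_pair hne] at hpair
  refine dvd_trans ?_ hpair
  have htwo {g : G} (hg : Commute t g) : (2 : ℤ) ∣ centralizerCard (ConjClasses.mk g) :=
    Int.natCast_dvd_natCast.2 (ht.symm.dvd.trans (orderOf_dvd_centralizerCard hg))
  exact mul_dvd_mul (htwo (Commute.refl t)) (htwo (Commute.one_right t))

theorem odd_intDisc (hG : Odd (Nat.card G)) : Odd (intDisc G) := by
  classical
  have : Fintype (ConjClasses G) := Fintype.ofFinite _
  rw [intDisc_eq_prod, quadChar_neg_one]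
  refine odd_neg_one.pow.mul
    (Finset.prod_induction _ Odd (fun _ _ => Odd.mul) odd_one fun C _ => ?_)
  exact (Int.odd_coe_nat _).2 (hG.of_dvd_nat (centralizerCard_dvd_card C))

theorem sign_intDisc : (intDisc G).sign = quadChar G (-1) := by
  classical
  have : Fintype (ConjClasses G) := Fintype.ofFinite _
  have hpos : 0 < ∏ C : ConjClasses G with IsRealClass C, (centralizerCard C : ℤ) :=
    Finset.prod_pos fun C _ => Int.natCast_pos.2 (centralizerCard_pos C)
  rw [intDisc_eq_prod, Int.sign_mul, Int.sign_eq_one_of_pos hpos, mul_one, quadChar_neg_one]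
  rcases neg_one_pow_eq_or ℤ (numComplexPairs G) with h | h <;> simp [h]

end Discriminant

section Reciprocity

variable {G : Type*} [Group G] [Finite G]

theorem legendreSym_intDisc {p : ℕ} [Fact p.Prime] (hp : ¬ p ∣ Nat.card G)
    [Fintype (ConjClasses G)] :
    legendreSym p (intDisc G) =
      legendreSym p (quadChar G (-1) * ∏ C : ConjClasses G, (centralizerCard C : ℤ)) := by
  classical
  have hcomplex : legendreSym.hom p (∏ C : ConjClasses G with ¬ IsRealClass C,
      (centralizerCard C : ℤ)) = 1 := by
    rw [map_prod]
    refine prod_not_isRealClass_eq_one fun C => ?_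
    rw [centralizerCard_classPow_neg_one, ← sq]
    refine legendreSym.sq_one p ?_
    rw [Int.cast_natCast, Ne, ZMod.natCast_eq_zero_iff]
    exact fun h => hp (h.trans (centralizerCard_dvd_card C))
  rw [intDisc_eq_prod, ← Finset.prod_filter_mul_prod_filter_not Finset.univ IsRealClass,
    ← mul_assoc, legendreSym.mul p (_ * _)]
  exact (mul_one _).symm.trans (congrArg _ hcomplex.symm)

theorem legendreSym_intDisc_eq_quadChar {p : ℕ} [Fact p.Prime] (hp2 : p ≠ 2)
    (hp : ¬ p ∣ Nat.card G) : legendreSym p (intDisc G) = quadChar G p := by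
  classical
  have : Fintype (ConjClasses G) := Fintype.ofFinite _
  have hgcd : Int.gcd p (Nat.card G) = 1 := (Fact.out : p.Prime).coprime_iff_not_dvd.2 hp
  have : NeZero (Nat.card G : AlgebraicClosure (ZMod p)) :=
    ⟨fun h => hp ((CharP.cast_eq_zero_iff _ p _).1 h)⟩
  obtain ⟨δ, hsq, hfrob⟩ :=
    exists_sq_eq_prod_centralizerCard (AlgebraicClosure (ZMod p)) p hgcd
  have hδ : δ ≠ 0 := by
    rw [← pow_ne_zero_iff two_ne_zero, hsq, quadChar_neg_one]
    push_cast
    exact mul_ne_zero (pow_ne_zero _ (neg_ne_zero.2 one_ne_zero))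
      (Finset.prod_ne_zero_iff.2 fun C _ => centralizerCard_cast_ne_zero C)
  have hchar := quadChar_intCast hgcd
  rw [Int.cast_natCast] at hchar
  rw [legendreSym_intDisc hp, hchar]
  exact legendreSym_eq_of_sq_eq hp2 hδ hsq hfrob

variable (G) in
theorem isKroneckerAwayFromTwo_quadChar : IsKroneckerAwayFromTwo (quadChar G) (intDisc G) where
  dvd := card_dvd_intDisc G
  even_of_even hd := by
    by_contra hG
    exact Int.not_odd_iff_even.2 hd (odd_intDisc (Nat.not_even_iff_odd.1 hG))
  neg_one := sign_intDisc.symm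
  odd_prime p hp hp2 := by
    have : Fact p.Prime := ⟨hp⟩
    rw [← jacobiSym.legendreSym.to_jacobiSym]
    by_cases hdvd : p ∣ Nat.card G
    · have hunit : ¬ IsUnit (p : ZMod (Nat.card G)) := fun hu =>
        hp.coprime_iff_not_dvd.1 ((ZMod.isUnit_iff_coprime _ _).1 hu) hdvd
      have hpd : (p : ℤ) ∣ intDisc G :=
        (Int.natCast_dvd_natCast.2 hdvd).trans (card_dvd_intDisc G)
      rw [MulChar.map_nonunit _ hunit, eq_comm, legendreSym.eq_zero_iff]
      exact (ZMod.intCast_zmod_eq_zero_iff_dvd _ _).2 hpd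
    · exact (legendreSym_intDisc_eq_quadChar hp2 hdvd).symm

end Reciprocity

end GroupReciprocity

theorem theorem1 (G : Type*) [Group G] [Finite G] :
    ∃ d : ℤ, (d : ℚ) = GroupReciprocity.groupDisc G ∧ d ≠ 0 ∧
      (d ≡ 0 [ZMOD 4] ∨ d ≡ 1 [ZMOD 4]) ∧
      (∀ a : ℤ, GroupReciprocity.quadSym G a = GroupReciprocity.kroneckerSym d a) ∧
      ((∀ a : ℤ, Int.gcd a (Nat.card G) = 1 → GroupReciprocity.quadSym G a = 1) ↔
        IsSquare d) := by
  open GroupReciprocity in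
  have h := isKroneckerAwayFromTwo_quadChar G
  have hmod : intDisc G ≡ 0 [ZMOD 4] ∨ intDisc G ≡ 1 [ZMOD 4] :=
    (Nat.even_or_odd (Nat.card G)).imp
      (fun hG => Int.modEq_zero_iff_dvd.2 (four_dvd_intDisc hG))
      (fun hG => h.emod_four_eq_one (odd_intDisc hG))
  exact ⟨intDisc G, intDisc_cast G, h.ne_zero, hmod,
    fun a => (quadSym_eq_quadChar a).trans (h.eq_kroneckerSym a),
    (forall_quadSym_eq_one_iff G).trans h.eq_one_iff⟩
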